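/- **Theorem (hierarchical option-critic policy gradient theorem).** Let $(\mathcal S,(\mathcal A_s)_s,R,P,\gamma)$ be a finite Markov decision process with rewards $R(s,a,s')$, transition probabilities $P(s'\mid s,a)$ and discount factor $\gamma\in[0,1)$. Let $N\ge 1$ and consider a tree of options with $N$ levels in which every non-leaf option has $M$ children. An option is given by its address $o^{1:j}=(o^1,\dots,o^j)$, $0\le j\le N-1$, $o^i\in\{1,\dots,M\}$ (the root is the empty address). For $j<N-1$ the option $o^{1:j}$ has a policy $\pi^{j+1}(\cdot\mid s_{o,j})=\pi^{j+1}(\cdot\mid s,o^{1:j})$ selecting a child $o^{j+1}$; a leaf option $o^{1:N-1}$ has a policy $\pi^N(\cdot\mid s_{o,N-1})$ selecting a primitive action $o^N\in\mathcal A_s$. Every option has a termination probability $\beta_j(s_{o,j})=\beta_j(s,o^{1:j})\in[0,1]$, with $\beta_0\equiv0$ (the root never terminates). *Execution.* In the state $s_{o,j,d}$ ("down", $j<N-1$) a child is selected by $\pi^{j+1}$ and the next state is $s_{o,j+1,d}$. In $s_{o,N-1,d}$ a primitive action $o^N$ is selected by $\pi^N$, which gives $s_{o,N,d}$; the environment then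 moves to $s'$ with probability $P(s'\mid s,o^N)$, the reward $R(s,o^N,s')$ is received, one unit of discounted time elapses, and the next state is $s'_{o,N-1,u}$ ("up"). In $s_{o,l,u}$ the next state is $s_{o,l-1,u}$ with probability $\beta_l(s_{o,l})$ and $s_{o,l,d}$ with probability $1-\beta_l(s_{o,l})$. Let $Q(x)$ be the expected discounted return of this Markov chain started at $x$, and put $$Q(s_{o,j-1,d},o^j)=Q(s_{o,j,d})\ (1\le j\le N),\qquad Q_{\beta_l}(s_{o,l},0)=Q(s_{o,l,d}),\qquad Q_{\beta_l}(s_{o,l},1)=Q(s_{o,l-1,u}).$$ Empty products are $1$ and empty sums are $0$. For $0\le l\le N-1$ let $$P_{\beta,\pi}(s_{o',l,d}\mid s_{o,l,u})=\sum_{i=0}^{l}(1-\beta_i(s_{o,i}))\Big(\prod_{j=i+1}^{l}\beta_j(s_{o,j})\Big)\Big(\prod_{p=i+1}^{l}\pi^p(o'^p\mid s_{o',p-1})\Big)\mathbf 1_{o'^{1:i}=o^{1:i}},$$ the probability that the upward phase started at $s_{o,l,u}$ is followed by a downward phase that reaches $s_{o',l,d}$. Let $P_\pi(s'\mid s_{o,N-1,d})=\sum_{o^N}\pi^N(o^N\mid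 s_{o,N-1})P(s'\mid s,o^N)$. Let $P_\gamma^{(k)}$ be the $k$-th power of the kernel $P^{(1)}_\gamma(s'_{o',N-1,d}\mid s_{o,N-1,d})=\gamma\,P_{\beta,\pi}(s'_{o',N-1,d}\mid s'_{o,N-1,u})\,P_\pi(s'\mid s_{o,N-1,d})$ on leaf states, and let $$\mu(s',s_{o,N-1,d}\mid x_0)=\Big(\sum_{k=0}^\infty P_\gamma^{(k)}(s_{o,N-1,d}\mid x_0)\Big)P_\pi(s'\mid s_{o,N-1,d}),$$ the discounted probability of reaching $s_{o,N-1,d}$ from $x_0$ and then $s'_{o,N-1,u}$ by the execution of $\pi^N$. *Claim.* Let all policies and termination functions depend on a common parameter $\theta$ (in a real normed space), and be differentiable at the parameter under consideration. Let $x_0=(s_0)_{o_0,N-1,d}$ for a state $s_0$ and a leaf option $o_0^{1:N-1}$. Then the series defining $Q$ and $\mu$ converge, $Q(x_0)$ is differentiable in $\theta$ at that parameter, and $$\begin{aligned}\frac{dQ}{d\theta}(x_0)=\sum_{s,\,o^{1:N-1},\,s'}\mu(s',s_{o,N-1,d}\mid x_0)\Big[&\sum_{o^N}\frac{d\pi^N}{d\theta}(o^N\mid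 s_{o,N-1})\,Q(s_{o,N-1,d},o^N)\\ &-\gamma\sum_{l=1}^{N-1}\Big(\prod_{k=l+1}^{N-1}\beta_k(s'_{o,k})\Big)\frac{d\beta_l}{d\theta}(s'_{o,l})\big(Q_{\beta_l}(s'_{o,l},0)-Q_{\beta_l}(s'_{o,l},1)\big)\\ &+\gamma\sum_{j=1}^{N-1}\Big(\prod_{k=j}^{N-1}\beta_k(s'_{o,k})\Big)\sum_{o'^{1:j}}P_{\beta,\pi}(s'_{o',j-1,d}\mid s'_{o,j-1,u})\frac{d\pi^j}{d\theta}(o'^{j}\mid s'_{o',j-1})\,Q(s'_{o',j-1,d},o'^j)\Big].\end{aligned}$$ -/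

import Mathlib

namespace HOC

/-- A finite Markov decision process with state set `S` and, at each state `s`, a finite set `Act s`
of available primitive actions.  `P s a` is the law of the next state, `R s a s'` is the reward of
the transition and `γ ∈ [0,1]` is the discount factor. -/
structure MDP (S : Type*) [Fintype S] (Act : S → Type*) where
  P : (s : S) → Act s → S → ℝ
  R : (s : S) → Act s → S → ℝ
  γ : ℝ
  P_nonneg : ∀ s a s', 0 ≤ P s a s'
  P_sum : ∀ s a, ∑ s', P s a s' = 1
  γ_nonneg : 0 ≤ γ
  γ_le_one : γ ≤ 1

/-- A node (option) of the option tree with `N` levels in which every non-leaf option has `M`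
children: its address `o^{1:j} = (o^1, …, o^j)`, with `0 ≤ j ≤ N - 1`. -/
def Node (M N : ℕ) : Type := {o : List (Fin M) // o.length < N}

namespace Node

variable {M N : ℕ}

instance : DecidableEq (Node M N) :=
  inferInstanceAs (DecidableEq {o : List (Fin M) // o.length < N})

instance : Finite (Node M N) := List.finite_length_lt (Fin M) N

noncomputable instance : Fintype (Node M N) := Fintype.ofFinite _

/-- The length `j` of the address `o^{1:j}`. -/
def len (o : Node M N) : ℕ := o.1.length

/-- The prefix `o^{1:i}` of an address. -/
def pre (o : Node M N) (i : ℕ) : Node M N :=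
  ⟨o.1.take i, lt_of_le_of_lt (List.length_take_le' i o.1) o.2⟩

/-- The parent `o^{1:j-1}` of `o^{1:j}` (the root is sent to itself; this value is never used). -/
def parent (o : Node M N) : Node M N := o.pre (o.len - 1)

/-- The child `(o^1, …, o^j, c)` of a non-leaf node (a leaf is sent to itself; this value is never
used). -/
def child (o : Node M N) (c : Fin M) : Node M N :=
  if h : (o.1 ++ [c]).length < N then ⟨o.1 ++ [c], h⟩ else o

/-- All addresses `o^{1:i}` of length `i`. -/
noncomputable def ofLen (M N i : ℕ) : Finset (Node M N) :=
  Finset.univ.filter (fun o => o.len = i)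

/-- The leaf nodes `o^{1:N-1}`. -/
noncomputable def leaves (M N : ℕ) : Finset (Node M N) := ofLen M N (N - 1)

end Node

/-- A hierarchical option-critic agent: the policy of each non-leaf option, which selects a child;
the policy of each leaf option, which selects a primitive action; and the termination probability
`beta s o` of each option.  The root never terminates.  In the usual notation,
`optPol s o^{1:j} c = π^{j+1}(c | s, o^{1:j})` for `j + 1 < N`,
`primPol s o^{1:N-1} a = π^N(a | s, o^{1:N-1})` and `beta s o^{1:j} = β_j(s, o^{1:j})`. -/
structure Agent (S : Type*) (Act : S → Type*) [∀ s, Fintype (Act s)] (M N : ℕ) where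
  optPol : S → Node M N → Fin M → ℝ
  primPol : (s : S) → Node M N → Act s → ℝ
  beta : S → Node M N → ℝ
  optPol_nonneg : ∀ s o c, o.len + 1 < N → 0 ≤ optPol s o c
  optPol_sum : ∀ s o, o.len + 1 < N → ∑ c, optPol s o c = 1
  primPol_nonneg : ∀ s o a, o.len + 1 = N → 0 ≤ primPol s o a
  primPol_sum : ∀ s o, o.len + 1 = N → ∑ a, primPol s o a = 1
  beta_nonneg : ∀ s o, 0 ≤ beta s o
  beta_le_one : ∀ s o, beta s o ≤ 1
  beta_root : ∀ s o, o.len = 0 → beta s o = 0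

/-- The states of environment and agent together.
`down s o^{1:i}`: the policy of the option `o^{1:i}` is about to be executed at `s`.
`act s o^{1:N-1} a`: the leaf option has selected the primitive action `a` at `s`
(this is the downward state at level `N`).
`up s o^{1:i}`: it is about to be decided whether the option `o^{1:i}` terminates at `s`. -/
inductive State (S : Type*) (Act : S → Type*) (M N : ℕ) where
  | down (s : S) (o : Node M N) : State S Act M N
  | act (s : S) (o : Node M N) (a : Act s) : State S Act M N
  | up (s : S) (o : Node M N) : State S Act M N

section

variable {S : Type*} [Fintype S] {Act : S → Type*} [∀ s, Fintype (Act s)] {M N : ℕ}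

/-- The one-step transition rule of the Markov chain of environment and agent, given through its
action on functions: `next D A f x` is the expected value of `f` at the successor of `x`.  A
non-leaf option selects a child; a leaf option selects a primitive action; a primitive action
changes the state of the environment and starts the upward phase; an option that terminates calls
its parent, and one that does not terminate is executed downward. -/
noncomputable def next (D : MDP S Act) (A : Agent S Act M N) (f : State S Act M N → ℝ) :
    State S Act M N → ℝ
  | .down s o =>
      if o.len + 1 < N then ∑ c, A.optPol s o c * f (.down s (o.child c))
      else ∑ a, A.primPol s o a * f (.act s o a)
  | .act s o a => ∑ s', D.P s a s' * f (.up s' o)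
  | .up s o => A.beta s o * f (.up s o.parent) + (1 - A.beta s o) * f (.down s o)

/-- The expected reward received on leaving a state: only primitive actions are rewarded. -/
noncomputable def reward (D : MDP S Act) : State S Act M N → ℝ
  | .act s _ a => ∑ s', D.P s a s' * D.R s a s'
  | _ => 0

/-- The discount incurred on leaving a state: time elapses only with primitive actions. -/
noncomputable def discount (D : MDP S Act) : State S Act M N → ℝ
  | .act _ _ _ => D.γ
  | _ => 1

/-- The expected discounted reward of the `n`-th transition of the chain started at `x`, that is,
the expectation of `γ ^ t` times the reward of this transition, where `t` is the number of
primitive actions taken before it. -/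
noncomputable def discReward (D : MDP S Act) (A : Agent S Act M N) : ℕ → State S Act M N → ℝ
  | 0, x => reward D x
  | n + 1, x => discount D x * next D A (discReward D A n) x

/-- The value `Q(x)`: the expected discounted return of the agent started at `x`. -/
noncomputable def Q (D : MDP S Act) (A : Agent S Act M N) (x : State S Act M N) : ℝ :=
  ∑' n, discReward D A n x

/-- The action value `Q(s_{o,N-1,d}, a)` of a primitive action at a leaf option. -/
noncomputable def QPrim (D : MDP S Act) (A : Agent S Act M N) (s : S) (o : Node M N)
    (a : Act s) : ℝ :=
  Q D A (.act s o a)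

/-- The action value `Q(s_{o,j-1,d}, c)` of the selection of the child `c` at a non-leaf option. -/
noncomputable def QOpt (D : MDP S Act) (A : Agent S Act M N) (s : S) (o : Node M N)
    (c : Fin M) : ℝ :=
  Q D A (.down s (o.child c))

/-- The action values `Q_{β_l}(s_{o,l}, b)` of the termination function of the option `o^{1:l}`:
the action `1` is to terminate, the action `0` is not to terminate. -/
noncomputable def QBeta (D : MDP S Act) (A : Agent S Act M N) (s : S) (o : Node M N) :
    Fin 2 → ℝ
  | 0 => Q D A (.down s o)
  | 1 => Q D A (.up s o.parent)

/-- The transition probability `P_{β,π}(s_{o',l,d} | s_{o,l,u})`, for `o` and `o'` of the same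
length `l`: it is the sum over the level `i` at which the upward phase ends. -/
noncomputable def upDownProb (A : Agent S Act M N) (s : S) (o' o : Node M N) : ℝ :=
  ∑ i ∈ Finset.range (o.len + 1),
    (1 - A.beta s (o.pre i)) * (∏ j ∈ Finset.Icc (i + 1) o.len, A.beta s (o.pre j)) *
      (∏ p : Fin o'.1.length, if i ≤ p.1 then A.optPol s (o'.pre p.1) (o'.1.get p) else 1) *
      (if o'.pre i = o.pre i then 1 else 0)

/-- The probability `P_π(s'_{o,N-1,u} | s_{o,N-1,d})` that the environment moves from `s` to `s'`
under the policy of the leaf option `o`. -/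
noncomputable def envProb (D : MDP S Act) (A : Agent S Act M N) (s' s : S) (o : Node M N) : ℝ :=
  ∑ a, A.primPol s o a * D.P s a s'

open Classical in
/-- The discounted `k`-step transition probability `P_γ^{(k)}(s'_{o',N-1,d} | s_{o,N-1,d})` between
leaf states, where one step is an execution of the leaf policy followed by an upward and a downward
phase. -/
noncomputable def leafProb (D : MDP S Act) (A : Agent S Act M N) :
    ℕ → S → Node M N → S → Node M N → ℝ
  | 0, s', o', s, o => if s' = s ∧ o' = o then 1 else 0
  | k + 1, s', o', s, o =>
      ∑ s'', ∑ o'' ∈ Node.leaves M N,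
        leafProb D A k s' o' s'' o'' *
          (D.γ * upDownProb A s'' o'' o * envProb D A s'' s o)

/-- The discounted occupancy `μ(s_{o,N-1,d} | (s₀)_{o₀,N-1,d})`. -/
noncomputable def occ (D : MDP S Act) (A : Agent S Act M N) (s : S) (o : Node M N)
    (s₀ : S) (o₀ : Node M N) : ℝ :=
  ∑' k, leafProb D A k s o s₀ o₀

/-- The discounted occupancy `μ(s', s_{o,N-1,d} | (s₀)_{o₀,N-1,d})` of reaching `s_{o,N-1,d}` and
then, by the execution of the leaf policy, `s'_{o,N-1,u}`. -/
noncomputable def occNext (D : MDP S Act) (A : Agent S Act M N) (s' s : S) (o : Node M N)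
    (s₀ : S) (o₀ : Node M N) : ℝ :=
  occ D A s o s₀ o₀ * envProb D A s' s o

end

end HOC

/-!
The value function `Q` solves the Bellman equation `Q = reward + T Q`, where `T` is the one-step
discounted transition operator of the chain on the finite set of states of environment and agent.
Only primitive actions are discounted, so `T` is not a contraction for the supremum norm.  But
between two primitive actions there are at most `2 * N` steps: `rank` decreases in each of them, and
so `T` is a contraction for the supremum norm with weight `w ^ rank x`, if `w > 1` is close to `1`
(`abs_discNext_le`).  Hence the series that defines `Q` converges and `1 - T` is injective; `Q` is
the solution of a regular linear system whose coefficients are differentiable in the parameter, and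
so it is differentiable by Cramer's rule (`differentiableAt_Q`).

The gradient formula is then obtained by differentiating the Bellman equation.  The derivative of
`Q` satisfies the same averaging relations as `Q`, with source terms that contain the derivatives of
the policies and of the termination functions.  These relations are unrolled along an upward and a
downward phase by induction on the level (`eq_sum_upDownProb`), which rests on the recursion
`upDownProb_child` for the kernel of the two phases.  This expresses the derivative at a leaf state
by a source term, which is the bracket of the theorem, and the derivatives at the leaf states
reached next.  Iterating along the leaf-to-leaf kernel, whose `k`-th power has total mass `γ ^ k`
(`sum_leafProb`), gives the integral of the source term against the discounted occupancy
(`eq_sum_occ_smul`).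
-/

namespace HOC

/-! ### Addresses in the option tree -/

namespace Node

variable {M N : ℕ}

theorem len_lt (o : Node M N) : o.len < N := o.2

theorem val_child {o : Node M N} (h : o.len + 1 < N) (c : Fin M) :
    (o.child c).1 = o.1 ++ [c] := by
  have h' : (o.1 ++ [c]).length < N := by simpa [len] using h
  have e : o.child c = ⟨o.1 ++ [c], h'⟩ := dif_pos h'
  rw [e]

theorem len_child {o : Node M N} (h : o.len + 1 < N) (c : Fin M) :
    (o.child c).len = o.len + 1 := by
  unfold len
  rw [val_child h]
  simp

theorem len_pre (o : Node M N) (i : ℕ) : (o.pre i).len = min i o.len := by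
  simp [len, pre]

theorem pre_pre (o : Node M N) (i j : ℕ) : (o.pre i).pre j = o.pre (min j i) := by
  apply Subtype.ext
  simp [pre, List.take_take]

theorem pre_of_len_le {o : Node M N} {i : ℕ} (h : o.len ≤ i) : o.pre i = o := by
  apply Subtype.ext
  simpa [pre, len] using h

theorem pre_child {o : Node M N} (h : o.len + 1 < N) (c : Fin M) {i : ℕ} (hi : i ≤ o.len) :
    (o.child c).pre i = o.pre i := by
  apply Subtype.ext
  simp only [pre]
  rw [val_child h, List.take_append_of_le_length hi]

theorem child_injective₂ {o o' : Node M N} (h : o.len + 1 < N) (h' : o'.len + 1 < N)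
    {c c' : Fin M} (e : o.child c = o'.child c') : o = o' ∧ c = c' := by
  have e' : o.1 ++ [c] = o'.1 ++ [c'] := by rw [← val_child h, ← val_child h', e]
  have := List.append_inj' e' rfl
  exact ⟨Subtype.ext this.1, by simpa using this.2⟩

theorem exists_eq_child {o : Node M N} (h : 0 < o.len) :
    ∃ c, o.parent.len + 1 < N ∧ o.parent.child c = o := by
  have hne : o.1 ≠ [] := List.ne_nil_of_length_pos h
  have hl : o.parent.len + 1 < N := by
    have := o.len_lt
    rw [parent, len_pre]; omega
  refine ⟨o.1.getLast hne, hl, ?_⟩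
  apply Subtype.ext
  rw [val_child hl]
  have : o.parent.1 = o.1.dropLast := by
    simp [parent, pre, len, List.dropLast_eq_take]
  rw [this, List.dropLast_append_getLast]

theorem mem_ofLen {i : ℕ} {o : Node M N} : o ∈ ofLen M N i ↔ o.len = i := by
  simp [ofLen]

/-- The nodes of level `i + 1` are the children of the nodes of level `i`. -/
theorem sum_ofLen_succ {G : Type*} [AddCommMonoid G] {i : ℕ} (h : i + 1 < N)
    (f : Node M N → G) :
    ∑ o ∈ ofLen M N (i + 1), f o = ∑ o ∈ ofLen M N i, ∑ c, f (o.child c) := by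
  rw [← Finset.sum_product']
  symm
  refine Finset.sum_bij (fun p _ => p.1.child p.2) ?_ ?_ ?_ ?_
  · rintro ⟨o, c⟩ hp
    simp only [Finset.mem_product, mem_ofLen] at hp
    dsimp only
    rw [mem_ofLen, len_child (by omega)]
    omega
  · rintro ⟨o, c⟩ hp ⟨o', c'⟩ hp' e
    simp only [Finset.mem_product, mem_ofLen] at hp hp'
    dsimp only at e
    obtain ⟨h1, h2⟩ := child_injective₂ (by omega) (by omega) e
    rw [h1, h2]
  · intro o ho
    rw [mem_ofLen] at ho
    obtain ⟨c, -, hc⟩ := exists_eq_child (o := o) (by omega)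
    refine ⟨(o.parent, c), ?_, hc⟩
    simp only [Finset.mem_product, mem_ofLen, Finset.mem_univ, and_true]
    rw [parent, len_pre]; omega
  · intros; rfl

theorem ofLen_zero {o : Node M N} (ho : o.len = 0) : ofLen M N 0 = {o} := by
  ext o'
  rw [mem_ofLen, Finset.mem_singleton]
  refine ⟨fun h => ?_, fun h => h ▸ ho⟩
  apply Subtype.ext
  rw [List.eq_nil_of_length_eq_zero h, List.eq_nil_of_length_eq_zero ho]

end Node

/-! ### The kernel of an upward and a downward phase -/

section UpDown

variable {S : Type*} {Act : S → Type*} [∀ s, Fintype (Act s)] {M N : ℕ}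

/-- The probability that a downward phase started at the prefix of length `i` of `o` follows the
address `o`: the product of the probabilities of the selections below level `i`. -/
noncomputable def downProb (A : Agent S Act M N) (s : S) (i : ℕ) (o : Node M N) : ℝ :=
  ∏ p : Fin o.1.length, if i ≤ p.1 then A.optPol s (o.pre p.1) (o.1.get p) else 1

theorem downProb_of_len_le (A : Agent S Act M N) (s : S) {i : ℕ} {o : Node M N}
    (h : o.len ≤ i) : downProb A s i o = 1 := by
  refine Finset.prod_eq_one fun p _ => if_neg ?_
  have := p.2
  unfold Node.len at h
  omega

theorem downProb_child (A : Agent S Act M N) (s : S) {i : ℕ} {o : Node M N}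
    (h : o.len + 1 < N) (c : Fin M) (hi : i ≤ o.len) :
    downProb A s i (o.child c) = downProb A s i o * A.optPol s o c := by
  -- Products over `Fin` of a list length become products over `Finset.range`.
  have key : ∀ o : Node M N, downProb A s i o = ∏ p ∈ Finset.range o.len,
      if hp : p < o.1.length then
        (if i ≤ p then A.optPol s (o.pre p) (o.1.get ⟨p, hp⟩) else 1) else 1 := by
    intro o
    unfold Node.len
    rw [← Fin.prod_univ_eq_prod_range]
    simp [downProb]
  rw [key, key, Node.len_child h, Finset.prod_range_succ]
  congr 1
  · refine Finset.prod_congr rfl fun p hp => ?_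
    rw [Finset.mem_range] at hp
    have hp' : p < o.1.length := hp
    have hp'' : p < (o.child c).1.length := by rw [Node.val_child h]; simp; omega
    rw [dif_pos hp', dif_pos hp'', Node.pre_child h c hp.le]
    have : (o.child c).1.get ⟨p, hp''⟩ = o.1.get ⟨p, hp'⟩ := by
      simp [Node.val_child h, List.getElem_append_left hp']
    rw [this]
  · have hp'' : o.len < (o.child c).1.length := by rw [Node.val_child h]; simp [Node.len]
    rw [dif_pos hp'', if_pos hi, Node.pre_child h c le_rfl, Node.pre_of_len_le le_rfl]
    congr 1
    simp [Node.val_child h, Node.len]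

theorem upDownProb_eq (A : Agent S Act M N) (s : S) (o' o : Node M N) :
    upDownProb A s o' o = ∑ i ∈ Finset.range (o.len + 1),
      (1 - A.beta s (o.pre i)) * (∏ j ∈ Finset.Icc (i + 1) o.len, A.beta s (o.pre j)) *
        downProb A s i o' * (if o'.pre i = o.pre i then 1 else 0) := rfl

theorem upDownProb_root (A : Agent S Act M N) (s : S) {o : Node M N} (ho : o.len = 0) :
    upDownProb A s o o = 1 := by
  rw [upDownProb_eq, ho, zero_add, Finset.sum_range_one, downProb_of_len_le A s ho.le,
    Node.pre_of_len_le ho.le, A.beta_root s o ho]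
  simp

/-- The first step of the upward phase: either the option does not terminate, or its parent is
called, and the downward phase then ends with a selection at the last level but one. -/
theorem upDownProb_child (A : Agent S Act M N) (s : S) {o' o : Node M N} (c : Fin M)
    (h : o'.len + 1 < N) (ho : o.len = o'.len + 1) :
    upDownProb A s (o'.child c) o =
      (1 - A.beta s o) * (if o'.child c = o then 1 else 0) +
        A.beta s o * (upDownProb A s o' o.parent * A.optPol s o' c) := by
  have hp : o.parent = o.pre o'.len := by rw [Node.parent, ho]; rfl
  have hpl : o.parent.len = o'.len := by rw [hp, Node.len_pre]; omega
  have hcl := Node.len_child h c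
  rw [upDownProb_eq, upDownProb_eq, ho, Finset.sum_range_succ, add_comm, hpl]
  congr 1
  · rw [downProb_of_len_le A s hcl.le, Node.pre_of_len_le ho.le, Node.pre_of_len_le hcl.le]
    simp
  · rw [Finset.sum_mul, Finset.mul_sum]
    refine Finset.sum_congr rfl fun i hi => ?_
    have hi' : i ≤ o'.len := Nat.lt_succ_iff.mp (Finset.mem_range.mp hi)
    have hpre : ∀ j ≤ o'.len, o.parent.pre j = o.pre j := fun j hj => by
      rw [hp, Node.pre_pre, min_eq_left hj]
    rw [downProb_child A s h c hi', Node.pre_child h c hi', hpre i hi',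
      Finset.prod_Icc_succ_top (by omega), Node.pre_of_len_le ho.le]
    have : ∏ j ∈ Finset.Icc (i + 1) o'.len, A.beta s (o.parent.pre j) =
        ∏ j ∈ Finset.Icc (i + 1) o'.len, A.beta s (o.pre j) :=
      Finset.prod_congr rfl fun j hj => by rw [hpre j (Finset.mem_Icc.mp hj).2]
    rw [this]
    ring

theorem upDownProb_nonneg (A : Agent S Act M N) (s : S) {o' : Node M N} (o : Node M N) :
    0 ≤ upDownProb A s o' o := by
  rw [upDownProb_eq]
  refine Finset.sum_nonneg fun i _ => ?_
  refine mul_nonneg (mul_nonneg (mul_nonneg ?_ ?_) ?_) ?_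
  · exact sub_nonneg.mpr (A.beta_le_one _ _)
  · exact Finset.prod_nonneg fun j _ => A.beta_nonneg _ _
  · refine Finset.prod_nonneg fun p _ => ?_
    split_ifs
    · refine A.optPol_nonneg _ _ _ ?_
      have h1 := p.2
      have h2 := o'.2
      rw [Node.len_pre, Node.len]
      omega
    · exact zero_le_one
  · split_ifs <;> norm_num

/-- Unrolling of one upward and downward phase.  `U` and `F` are quantities attached to the upward
and the downward states at `s`, which satisfy the averaging relations of the chain up to the source
terms `bU` and `bF`.  Then `U o` is the average of `F` over the options of the same level that are
reached next, plus the source terms met on the way. -/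
theorem eq_sum_upDownProb {G : Type*} [AddCommGroup G] [Module ℝ G] (A : Agent S Act M N) (s : S)
    {U F bU bF : Node M N → G}
    (hU : ∀ o, U o = bU o + A.beta s o • U o.parent + (1 - A.beta s o) • F o)
    (hF : ∀ o, o.len + 1 < N → F o = bF o + ∑ c, A.optPol s o c • F (o.child c))
    (hroot : ∀ o, o.len = 0 → bU o = 0) (l : ℕ) :
    ∀ o : Node M N, o.len = l →
      U o = (∑ k ∈ Finset.Icc 1 l,
          (∏ m ∈ Finset.Icc (k + 1) l, A.beta s (o.pre m)) • bU (o.pre k)) +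
        (∑ j ∈ Finset.Icc 1 l, (∏ k ∈ Finset.Icc j l, A.beta s (o.pre k)) •
          ∑ o' ∈ Node.ofLen M N (j - 1), upDownProb A s o' (o.pre (j - 1)) • bF o') +
        ∑ o' ∈ Node.ofLen M N l, upDownProb A s o' o • F o' := by
  induction l with
  | zero =>
    intro o ho
    rw [Node.ofLen_zero ho, Finset.sum_singleton, upDownProb_root A s ho, hU o, hroot o ho,
      A.beta_root s o ho]
    simp
  | succ l ih =>
    intro o ho
    have hlN : l + 1 < N := ho ▸ o.len_lt
    have hp : o.parent = o.pre l := by rw [Node.parent, ho]; rfl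
    have hpl : o.parent.len = l := by rw [hp, Node.len_pre]; omega
    have hpre : ∀ j ≤ l, o.parent.pre j = o.pre j := fun j hj => by
      rw [hp, Node.pre_pre, min_eq_left hj]
    have hself : o.pre (l + 1) = o := Node.pre_of_len_le ho.le
    have hprod : ∀ i ≤ l + 1, ∏ m ∈ Finset.Icc i (l + 1), A.beta s (o.pre m) =
        A.beta s o * ∏ m ∈ Finset.Icc i l, A.beta s (o.parent.pre m) := fun i hi => by
      rw [Finset.prod_Icc_succ_top hi, hself, mul_comm]
      congr 1
      exact Finset.prod_congr rfl fun j hj => by rw [hpre j (Finset.mem_Icc.mp hj).2]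
    have e1 : ∑ k ∈ Finset.Icc 1 (l + 1),
          (∏ m ∈ Finset.Icc (k + 1) (l + 1), A.beta s (o.pre m)) • bU (o.pre k) =
        A.beta s o • (∑ k ∈ Finset.Icc 1 l,
          (∏ m ∈ Finset.Icc (k + 1) l, A.beta s (o.parent.pre m)) • bU (o.parent.pre k)) +
        bU o := by
      rw [Finset.sum_Icc_succ_top (by omega), hself, Finset.smul_sum]
      congr 1
      · refine Finset.sum_congr rfl fun k hk => ?_
        have hk' := (Finset.mem_Icc.mp hk).2
        rw [hprod _ (by omega), mul_smul, hpre k hk']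
      · simp
    have e2 : ∑ j ∈ Finset.Icc 1 (l + 1), (∏ k ∈ Finset.Icc j (l + 1), A.beta s (o.pre k)) •
          ∑ o' ∈ Node.ofLen M N (j - 1), upDownProb A s o' (o.pre (j - 1)) • bF o' =
        A.beta s o • (∑ j ∈ Finset.Icc 1 l, (∏ k ∈ Finset.Icc j l, A.beta s (o.parent.pre k)) •
          ∑ o' ∈ Node.ofLen M N (j - 1), upDownProb A s o' (o.parent.pre (j - 1)) • bF o') +
        A.beta s o • ∑ o' ∈ Node.ofLen M N l, upDownProb A s o' o.parent • bF o' := by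
      rw [Finset.sum_Icc_succ_top (by omega)]
      congr 1
      · rw [Finset.smul_sum]
        refine Finset.sum_congr rfl fun j hj => ?_
        have hj' := (Finset.mem_Icc.mp hj).2
        rw [hprod _ (by omega), mul_smul, hpre _ (by omega)]
      · simp [hself, hp]
    have e3 : ∑ o' ∈ Node.ofLen M N (l + 1), upDownProb A s o' o • F o' =
        (1 - A.beta s o) • F o + A.beta s o • ∑ o' ∈ Node.ofLen M N l,
          upDownProb A s o' o.parent • ∑ c, A.optPol s o' c • F (o'.child c) := by
      have e : ∀ o' ∈ Node.ofLen M N l, ∑ c, upDownProb A s (o'.child c) o • F (o'.child c) =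
          (∑ c, (1 - A.beta s o) • (if o'.child c = o then F (o'.child c) else 0)) +
          A.beta s o • upDownProb A s o' o.parent • ∑ c, A.optPol s o' c • F (o'.child c) := by
        intro o' ho'
        rw [Node.mem_ofLen] at ho'
        rw [Finset.smul_sum, Finset.smul_sum, ← Finset.sum_add_distrib]
        refine Finset.sum_congr rfl fun c _ => ?_
        rw [upDownProb_child A s c (by omega) (by omega), add_smul, mul_smul, mul_smul, mul_smul,
          ite_smul, one_smul, zero_smul]
      rw [Node.sum_ofLen_succ hlN, Finset.sum_congr rfl e, Finset.sum_add_distrib,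
        ← Node.sum_ofLen_succ hlN (fun o' => (1 - A.beta s o) • (if o' = o then F o' else 0)),
        ← Finset.smul_sum, ← Finset.smul_sum, Finset.sum_ite_eq',
        if_pos (Node.mem_ofLen.mpr ho)]
    have e4 : ∑ o' ∈ Node.ofLen M N l, upDownProb A s o' o.parent • F o' =
        ∑ o' ∈ Node.ofLen M N l, upDownProb A s o' o.parent • bF o' +
        ∑ o' ∈ Node.ofLen M N l,
          upDownProb A s o' o.parent • ∑ c, A.optPol s o' c • F (o'.child c) := by
      rw [← Finset.sum_add_distrib]
      refine Finset.sum_congr rfl fun o' ho' => ?_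
      rw [Node.mem_ofLen] at ho'
      rw [hF o' (by omega), smul_add]
    rw [e1, e2, e3, hU o, ih o.parent hpl, e4]
    simp only [smul_add]
    abel

theorem sum_upDownProb (A : Agent S Act M N) (s : S) {l : ℕ} {o : Node M N} (ho : o.len = l) :
    ∑ o' ∈ Node.ofLen M N l, upDownProb A s o' o = 1 := by
  have := eq_sum_upDownProb A s (U := fun _ => (1 : ℝ)) (F := fun _ => 1) (bU := fun _ => 0)
    (bF := fun _ => 0) (by intro o; simp) (by intro o h; simp [A.optPol_sum s o h])
    (fun _ _ => rfl) l o ho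
  simpa using this.symm

end UpDown

/-! ### Decay of the discounted transition operator and the Bellman equation -/

section Bellman

/-- An upper bound for the number of steps until the chain reaches a state `act`. -/
def rank {S : Type*} {Act : S → Type*} {M N : ℕ} : State S Act M N → ℕ
  | .down _ o => N - o.len
  | .act _ _ _ => 0
  | .up _ o => N + 1 + o.len

theorem rank_le {S : Type*} {Act : S → Type*} {M N : ℕ} (x : State S Act M N) :
    rank x ≤ 2 * N := by
  cases x with
  | down s o => simp only [rank]; omega
  | act s o a => simp only [rank]; omega
  | up s o => have := o.len_lt; simp only [rank]; omega

variable {S : Type*} [Fintype S] {Act : S → Type*} [∀ s, Fintype (Act s)] {M N : ℕ}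

instance : Finite (State S Act M N) :=
  Finite.of_surjective
    (fun x : (S × Node M N) ⊕ (S × Node M N) ⊕ (Σ s, Node M N × Act s) =>
      match x with
      | .inl p => State.down p.1 p.2
      | .inr (.inl p) => State.up p.1 p.2
      | .inr (.inr p) => State.act p.1 p.2.1 p.2.2)
    (by
      rintro (⟨s, o⟩ | ⟨s, o, a⟩ | ⟨s, o⟩)
      · exact ⟨.inl (s, o), rfl⟩
      · exact ⟨.inr (.inr ⟨s, o, a⟩), rfl⟩
      · exact ⟨.inr (.inl (s, o)), rfl⟩)

theorem next_act (D : MDP S Act) (A : Agent S Act M N) (f : State S Act M N → ℝ) (s : S)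
    (o : Node M N) (a : Act s) : next D A f (.act s o a) = ∑ s', D.P s a s' * f (.up s' o) := rfl

theorem next_up (D : MDP S Act) (A : Agent S Act M N) (f : State S Act M N → ℝ) (s : S)
    (o : Node M N) : next D A f (.up s o) =
      A.beta s o * f (.up s o.parent) + (1 - A.beta s o) * f (.down s o) := rfl

theorem next_down_of_lt (D : MDP S Act) (A : Agent S Act M N) (f : State S Act M N → ℝ) (s : S)
    {o : Node M N} (h : o.len + 1 < N) :
    next D A f (.down s o) = ∑ c, A.optPol s o c * f (.down s (o.child c)) := if_pos h

theorem next_down_leaf (D : MDP S Act) (A : Agent S Act M N) (f : State S Act M N → ℝ) (s : S)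
    {o : Node M N} (h : o.len + 1 = N) :
    next D A f (.down s o) = ∑ a, A.primPol s o a * f (.act s o a) := if_neg (by omega)

/-- The expected discounted value `discount x * next D A f x` of `f` at the successor of `x`, as a
linear operator on functions. -/
noncomputable def discNext (D : MDP S Act) (A : Agent S Act M N) :
    (State S Act M N → ℝ) →ₗ[ℝ] (State S Act M N → ℝ) where
  toFun f x := discount D x * next D A f x
  map_add' f g := by
    funext x
    rw [Pi.add_apply, ← mul_add]
    congr 1
    cases x with
    | down s o =>
      simp only [next]
      split_ifs <;> simp [mul_add, Finset.sum_add_distrib]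
    | act s o a => simp [next, mul_add, Finset.sum_add_distrib]
    | up s o => simp only [next, Pi.add_apply]; ring
  map_smul' r f := by
    funext x
    rw [RingHom.id_apply, Pi.smul_apply, smul_eq_mul, mul_left_comm]
    congr 1
    cases x with
    | down s o =>
      simp only [next]
      split_ifs <;> simp [Finset.mul_sum, mul_left_comm]
    | act s o a => simp [next, Finset.mul_sum, mul_left_comm]
    | up s o => simp only [next, Pi.smul_apply, smul_eq_mul]; ring

theorem discNext_apply (D : MDP S Act) (A : Agent S Act M N) (f : State S Act M N → ℝ)
    (x : State S Act M N) : discNext D A f x = discount D x * next D A f x := rfl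

theorem discReward_succ (D : MDP S Act) (A : Agent S Act M N) (n : ℕ) :
    discReward D A (n + 1) = discNext D A (discReward D A n) := rfl

theorem abs_sum_mul_le {ι : Type*} [Fintype ι] {p f : ι → ℝ} {C : ℝ} (hp : ∀ i, 0 ≤ p i)
    (h1 : ∑ i, p i = 1) (hf : ∀ i, |f i| ≤ C) : |∑ i, p i * f i| ≤ C :=
  calc |∑ i, p i * f i| ≤ ∑ i, |p i * f i| := Finset.abs_sum_le_sum_abs _ _
    _ ≤ ∑ i, p i * C := Finset.sum_le_sum fun i _ => by
        rw [abs_mul, abs_of_nonneg (hp i)]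
        exact mul_le_mul_of_nonneg_left (hf i) (hp i)
    _ = C := by rw [← Finset.sum_mul, h1, one_mul]

/-- Contraction with respect to the weight `w ^ rank x`.  Off the primitive actions each step of
positive probability decreases the rank, which gains a factor `w⁻¹ ≤ r`; at a primitive action the
weight grows at most by `w ^ (2 * N)`, which the discount factor compensates. -/
theorem abs_discNext_le (D : MDP S Act) (A : Agent S Act M N) {w C r : ℝ} (hw : 1 < w)
    (hC : 0 ≤ C) (hr1 : 1 ≤ r * w) (hr2 : D.γ * w ^ (2 * N) ≤ r) {f : State S Act M N → ℝ}
    (hf : ∀ x, |f x| ≤ C * w ^ rank x) (x : State S Act M N) :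
    |discNext D A f x| ≤ r * C * w ^ rank x := by
  have hw0 : (0 : ℝ) ≤ w := by linarith
  have hmono : ∀ {m n : ℕ}, m ≤ n → C * w ^ m ≤ C * w ^ n := fun h =>
    mul_le_mul_of_nonneg_left (pow_le_pow_right₀ hw.le h) hC
  have hdec : ∀ {m n : ℕ}, m + 1 ≤ n → C * w ^ m ≤ r * C * w ^ n := fun {m n} h =>
    calc C * w ^ m ≤ (r * w) * (C * w ^ m) := by
          nlinarith [mul_nonneg hC (pow_nonneg hw0 m)]
      _ = r * (C * w ^ (m + 1)) := by ring
      _ ≤ r * (C * w ^ n) := mul_le_mul_of_nonneg_left (hmono h)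
          ((mul_nonneg D.γ_nonneg (pow_nonneg hw0 _)).trans hr2)
      _ = r * C * w ^ n := by ring
  rw [discNext_apply]
  cases x with
  | down s o =>
    have ho := o.len_lt
    simp only [discount, one_mul]
    by_cases h : o.len + 1 < N
    · rw [next_down_of_lt D A f s h]
      refine (abs_sum_mul_le (C := C * w ^ (N - (o.len + 1)))
        (fun c => A.optPol_nonneg s o c h) (A.optPol_sum s o h) fun c => ?_).trans
        (hdec (by simp only [rank]; omega))
      have := hf (.down s (o.child c))
      simpa only [rank, Node.len_child h] using this
    · have h' : o.len + 1 = N := by omega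
      rw [next_down_leaf D A f s h']
      exact (abs_sum_mul_le (C := C * w ^ 0) (fun a => A.primPol_nonneg s o a h')
        (A.primPol_sum s o h') fun a => hf (.act s o a)).trans
        (hdec (by simp only [rank]; omega))
  | act s o a =>
    simp only [discount]
    have h1 : |next D A f (.act s o a)| ≤ C * w ^ (2 * N) := by
      rw [next_act]
      exact abs_sum_mul_le (D.P_nonneg s a) (D.P_sum s a)
        fun s' => (hf _).trans (hmono (rank_le _))
    rw [abs_mul, abs_of_nonneg D.γ_nonneg]
    calc D.γ * |next D A f (.act s o a)| ≤ D.γ * (C * w ^ (2 * N)) :=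
          mul_le_mul_of_nonneg_left h1 D.γ_nonneg
      _ = C * (D.γ * w ^ (2 * N)) := by ring
      _ ≤ C * r := mul_le_mul_of_nonneg_left hr2 hC
      _ = r * C * w ^ rank (State.act s o a : State S Act M N) := by simp [rank, mul_comm]
  | up s o =>
    simp only [discount, one_mul]
    rw [next_up]
    have hb0 := A.beta_nonneg s o
    have hb1 := A.beta_le_one s o
    have hd : |f (.down s o)| ≤ r * C * w ^ rank (State.up s o : State S Act M N) :=
      (hf _).trans (hdec (by simp only [rank]; omega))
    -- The root is its own parent, but it terminates with probability zero.
    by_cases h0 : o.len = 0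
    · rw [A.beta_root s o h0]
      simpa using hd
    · have hu : |f (.up s o.parent)| ≤ r * C * w ^ rank (State.up s o : State S Act M N) := by
        refine (hf _).trans (hdec ?_)
        simp only [rank, Node.parent, Node.len_pre]
        omega
      refine (abs_add_le _ _).trans ?_
      rw [abs_mul, abs_mul, abs_of_nonneg hb0, abs_of_nonneg (sub_nonneg.mpr hb1)]
      nlinarith

/-- There is a geometric rate at which the iterates of the discounted transition operator decay. -/
theorem exists_abs_iterate_discNext_le (D : MDP S Act) (hγ : D.γ < 1) (A : Agent S Act M N)
    (f : State S Act M N → ℝ) :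
    ∃ C r : ℝ, 0 ≤ r ∧ r < 1 ∧ ∀ n x, |(discNext D A)^[n] f x| ≤ C * r ^ n := by
  obtain ⟨w, hw1, hw⟩ : ∃ w : ℝ, 1 < w ∧ D.γ * w ^ (2 * N) < 1 := by
    have hc : Filter.Tendsto (fun w : ℝ => D.γ * w ^ (2 * N)) (nhdsWithin 1 (Set.Ioi 1))
        (nhds (D.γ * 1 ^ (2 * N))) :=
      ((by fun_prop : Continuous fun w : ℝ => D.γ * w ^ (2 * N)).tendsto 1).mono_left
        nhdsWithin_le_nhds
    obtain ⟨w, h1, h2⟩ := ((hc.eventually (gt_mem_nhds (by simpa using hγ))).and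
      self_mem_nhdsWithin).exists
    exact ⟨w, h2, h1⟩
  have hw0 : (0 : ℝ) < w := by linarith
  set r : ℝ := max w⁻¹ (D.γ * w ^ (2 * N)) with hr
  have hr0 : 0 ≤ r := (inv_nonneg.mpr hw0.le).trans (le_max_left _ _)
  have hr1 : 1 ≤ r * w := by
    rw [← inv_mul_cancel₀ hw0.ne']
    exact mul_le_mul_of_nonneg_right (le_max_left _ _) hw0.le
  obtain ⟨B, hB⟩ := (Set.finite_range fun x => |f x|).bddAbove
  have hfB : ∀ x, |f x| ≤ max B 0 := fun x => (hB ⟨x, rfl⟩).trans (le_max_left _ _)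
  have hB0 : 0 ≤ max B 0 := le_max_right _ _
  have key : ∀ n x, |(discNext D A)^[n] f x| ≤ r ^ n * max B 0 * w ^ rank x := by
    intro n
    induction n with
    | zero =>
      intro x
      rw [pow_zero, one_mul]
      exact (hfB x).trans (le_mul_of_one_le_right hB0 (one_le_pow₀ hw1.le))
    | succ n ih =>
      intro x
      rw [Function.iterate_succ_apply', pow_succ', mul_assoc r]
      exact abs_discNext_le D A hw1 (mul_nonneg (pow_nonneg hr0 n) hB0) hr1 (le_max_right _ _) ih x
  refine ⟨max B 0 * w ^ (2 * N), r, hr0, max_lt (inv_lt_one_of_one_lt₀ hw1) hw, fun n x => ?_⟩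
  calc _ ≤ r ^ n * max B 0 * w ^ rank x := key n x
    _ ≤ r ^ n * max B 0 * w ^ (2 * N) := mul_le_mul_of_nonneg_left
        (pow_le_pow_right₀ hw1.le (rank_le x)) (mul_nonneg (pow_nonneg hr0 n) hB0)
    _ = _ := by ring

theorem discReward_eq_iterate (D : MDP S Act) (A : Agent S Act M N) (n : ℕ) :
    discReward D A n = (discNext D A)^[n] (reward D) := by
  induction n with
  | zero => rfl
  | succ n ih => rw [discReward_succ, ih, Function.iterate_succ_apply']

theorem summable_discReward (D : MDP S Act) (hγ : D.γ < 1) (A : Agent S Act M N)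
    (x : State S Act M N) : Summable fun n => discReward D A n x := by
  obtain ⟨C, r, hr0, hr1, h⟩ := exists_abs_iterate_discNext_le D hγ A (reward D)
  refine Summable.of_norm_bounded ((summable_geometric_of_lt_one hr0 hr1).mul_left C) fun n => ?_
  rw [discReward_eq_iterate, Real.norm_eq_abs]
  exact h n x

theorem eq_zero_of_discNext_eq (D : MDP S Act) (hγ : D.γ < 1) (A : Agent S Act M N)
    {f : State S Act M N → ℝ} (hf : discNext D A f = f) : f = 0 := by
  obtain ⟨C, r, hr0, hr1, h⟩ := exists_abs_iterate_discNext_le D hγ A f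
  funext x
  have hlim : Filter.Tendsto (fun n : ℕ => C * r ^ n) Filter.atTop (nhds 0) := by
    simpa using (tendsto_pow_atTop_nhds_zero_of_lt_one hr0 hr1).const_mul C
  have hle : |f x| ≤ 0 := ge_of_tendsto' hlim fun n => by
    have := h n x
    rwa [Function.iterate_fixed hf n] at this
  simpa using hle

/-- The Bellman equation. -/
theorem Q_eq (D : MDP S Act) (hγ : D.γ < 1) (A : Agent S Act M N) (x : State S Act M N) :
    Q D A x = reward D x + discount D x * next D A (Q D A) x := by
  have hs := fun x => summable_discReward D hγ A x
  have hn : HasSum (fun n => discReward D A n) (Q D A) :=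
    Pi.hasSum.mpr fun x => (hs x).hasSum
  have hT : HasSum (fun n => discNext D A (discReward D A n)) (discNext D A (Q D A)) :=
    hn.map (discNext D A) (discNext D A).continuous_of_finiteDimensional
  have := (hs x).tsum_eq_zero_add
  rw [← discNext_apply, ← (Pi.hasSum.mp hT x).tsum_eq]
  exact this

/-! ### Differentiability of the value function -/

section Differentiability

variable {E : Type*} [NormedAddCommGroup E] [NormedSpace ℝ E]

open Classical in
/-- The solution of a square linear system whose matrix depends differentiably on a parameter is
differentiable wherever the matrix is regular.  By Cramer's rule it is a quotient of polynomials in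
the entries. -/
theorem differentiableAt_of_mulVec_eq {X : Type*} [Fintype X] {K : E → Matrix X X ℝ}
    {q : E → X → ℝ} {b : X → ℝ} {θ : E} (hK : ∀ i j, DifferentiableAt ℝ (fun t => K t i j) θ)
    (h0 : (K θ).det ≠ 0) (hq : ∀ t, (K t).mulVec (q t) = b) (x : X) :
    DifferentiableAt ℝ (fun t => q t x) θ := by
  have hdet : ∀ {L : E → Matrix X X ℝ}, (∀ i j, DifferentiableAt ℝ (fun t => L t i j) θ) →
      DifferentiableAt ℝ (fun t => (L t).det) θ := by
    intro L hL
    simp only [Matrix.det_apply]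
    refine DifferentiableAt.fun_sum fun σ _ => DifferentiableAt.const_smul ?_ _
    exact (HasFDerivAt.finsetProd fun i _ => (hL (σ i) i).hasFDerivAt).differentiableAt
  have hev : ∀ᶠ t in nhds θ, (K t).det ≠ 0 := (hdet hK).continuousAt.eventually_ne h0
  have hnum : DifferentiableAt ℝ (fun t => ((K t).updateCol x b).det) θ := by
    refine hdet fun i j => ?_
    by_cases hj : j = x
    · subst hj
      simp
    · simpa [Matrix.updateCol_ne hj] using hK i j
  refine (hnum.mul ((hdet hK).inv h0)).congr_of_eventuallyEq ?_
  filter_upwards [hev] with t ht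
  have h1 : (K t).cramer b = (K t).det • q t := by
    rw [Matrix.cramer_eq_adjugate_mulVec, ← hq t, Matrix.mulVec_mulVec, Matrix.adjugate_mul,
      Matrix.smul_mulVec, Matrix.one_mulVec]
  have h2 := congrFun h1 x
  rw [Matrix.cramer_apply, Pi.smul_apply, smul_eq_mul] at h2
  rw [Pi.mul_apply, Pi.inv_apply, h2, mul_comm, inv_mul_cancel_left₀ ht]

variable {A : E → Agent S Act M N} {θ : E}

theorem differentiableAt_discNext (D : MDP S Act)
    (h_opt : ∀ s o c, o.len + 1 < N → DifferentiableAt ℝ (fun t => (A t).optPol s o c) θ)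
    (h_prim : ∀ s o a, o.len + 1 = N → DifferentiableAt ℝ (fun t => (A t).primPol s o a) θ)
    (h_beta : ∀ s o, DifferentiableAt ℝ (fun t => (A t).beta s o) θ)
    (f : State S Act M N → ℝ) (x : State S Act M N) :
    DifferentiableAt ℝ (fun t => discNext D (A t) f x) θ := by
  simp only [discNext_apply]
  refine DifferentiableAt.const_mul ?_ _
  cases x with
  | down s o =>
    by_cases h : o.len + 1 < N
    · simp only [next_down_of_lt D _ f s h]
      exact DifferentiableAt.fun_sum fun c _ => (h_opt s o c h).mul_const _
    · have h' : o.len + 1 = N := by have := o.len_lt; omega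
      simp only [next_down_leaf D _ f s h']
      exact DifferentiableAt.fun_sum fun a _ => (h_prim s o a h').mul_const _
  | act s o a => simp only [next_act]; exact differentiableAt_const _
  | up s o =>
    simp only [next_up]
    exact ((h_beta s o).mul_const _).add (((h_beta s o).const_sub 1).mul_const _)

open Classical in
theorem differentiableAt_Q (D : MDP S Act) (hγ : D.γ < 1)
    (h_opt : ∀ s o c, o.len + 1 < N → DifferentiableAt ℝ (fun t => (A t).optPol s o c) θ)
    (h_prim : ∀ s o a, o.len + 1 = N → DifferentiableAt ℝ (fun t => (A t).primPol s o a) θ)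
    (h_beta : ∀ s o, DifferentiableAt ℝ (fun t => (A t).beta s o) θ)
    (x : State S Act M N) : DifferentiableAt ℝ (fun t => Q D (A t) x) θ := by
  have : Fintype (State S Act M N) := Fintype.ofFinite _
  refine differentiableAt_of_mulVec_eq (b := reward D)
    (K := fun t => LinearMap.toMatrix' (LinearMap.id - discNext D (A t))) ?_ ?_ ?_ x
  · intro i j
    simp only [LinearMap.toMatrix'_apply, LinearMap.sub_apply, Pi.sub_apply]
    exact (differentiableAt_discNext D h_opt h_prim h_beta _ i).const_sub _
  · intro h
    obtain ⟨v, hv0, hv⟩ := Matrix.exists_mulVec_eq_zero_iff.mpr h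
    rw [LinearMap.toMatrix'_mulVec, LinearMap.sub_apply, LinearMap.id_apply, sub_eq_zero] at hv
    exact hv0 (eq_zero_of_discNext_eq D hγ (A θ) hv.symm)
  · intro t
    rw [LinearMap.toMatrix'_mulVec]
    funext y
    rw [LinearMap.sub_apply, LinearMap.id_apply, Pi.sub_apply, discNext_apply,
      sub_eq_iff_eq_add]
    exact Q_eq D hγ (A t) y

end Differentiability

end Bellman

/-! ### The leaf-to-leaf kernel and the discounted occupancy -/

section Leaves

variable {S : Type*} [Fintype S] {Act : S → Type*} [∀ s, Fintype (Act s)] {M N : ℕ}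

theorem envProb_nonneg (D : MDP S Act) (A : Agent S Act M N) (s' s : S) {o : Node M N}
    (h : o.len + 1 = N) : 0 ≤ envProb D A s' s o :=
  Finset.sum_nonneg fun a _ => mul_nonneg (A.primPol_nonneg s o a h) (D.P_nonneg s a s')

theorem sum_envProb (D : MDP S Act) (A : Agent S Act M N) (s : S) {o : Node M N}
    (h : o.len + 1 = N) : ∑ s', envProb D A s' s o = 1 := by
  simp only [envProb]
  rw [Finset.sum_comm]
  simp_rw [← Finset.mul_sum, D.P_sum, mul_one]
  exact A.primPol_sum s o h

theorem len_of_mem_leaves {o : Node M N} (h : o ∈ Node.leaves M N) : o.len + 1 = N := by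
  have h1 := Node.mem_ofLen.mp h
  have h2 := o.len_lt
  omega

theorem leafProb_nonneg (D : MDP S Act) (A : Agent S Act M N) (k : ℕ) (s' : S) (o' : Node M N) :
    ∀ (s : S) (o : Node M N), o ∈ Node.leaves M N → 0 ≤ leafProb D A k s' o' s o := by
  induction k with
  | zero =>
    intro s o _
    simp only [leafProb]
    split_ifs <;> norm_num
  | succ k ih =>
    intro s o ho
    simp only [leafProb]
    exact Finset.sum_nonneg fun s'' _ => Finset.sum_nonneg fun o'' ho'' =>
      mul_nonneg (ih s'' o'' ho'') (mul_nonneg (mul_nonneg D.γ_nonneg (upDownProb_nonneg A s'' o))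
        (envProb_nonneg D A s'' s (len_of_mem_leaves ho)))

/-- Averages of a function over the leaf states after `k + 1` steps are computed by conditioning on
the first step. -/
theorem sum_leafProb_succ_smul {G : Type*} [AddCommGroup G] [Module ℝ G] (D : MDP S Act)
    (A : Agent S Act M N) (k : ℕ) (f : S → Node M N → G) (s : S) (o : Node M N) :
    ∑ s', ∑ o' ∈ Node.leaves M N, leafProb D A (k + 1) s' o' s o • f s' o' =
      ∑ s'', ∑ o'' ∈ Node.leaves M N, (D.γ * upDownProb A s'' o'' o * envProb D A s'' s o) •
        ∑ s', ∑ o' ∈ Node.leaves M N, leafProb D A k s' o' s'' o'' • f s' o' := by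
  simp only [leafProb, ← Finset.sum_product', Finset.sum_smul, Finset.smul_sum]
  refine Finset.sum_nbij' (fun x => (x.2.2.1, x.2.2.2, x.1, x.2.1))
    (fun x => (x.2.2.1, x.2.2.2, x.1, x.2.1)) ?_ ?_ (fun _ _ => rfl) (fun _ _ => rfl)
    fun x _ => ?_
  · intro x hx
    simp only [Finset.mem_product, Finset.mem_univ, true_and] at hx ⊢
    exact hx.symm
  · intro x hx
    simp only [Finset.mem_product, Finset.mem_univ, true_and] at hx ⊢
    exact hx.symm
  · rw [smul_smul, mul_comm]

theorem sum_leafProb_zero_smul {G : Type*} [AddCommGroup G] [Module ℝ G] (D : MDP S Act)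
    (A : Agent S Act M N) (f : S → Node M N → G) (s : S) {o : Node M N}
    (ho : o ∈ Node.leaves M N) :
    ∑ s', ∑ o' ∈ Node.leaves M N, leafProb D A 0 s' o' s o • f s' o' = f s o := by
  rw [Finset.sum_eq_single s, Finset.sum_eq_single o]
  · simp [leafProb]
  · intro o' _ h
    simp [leafProb, h]
  · exact fun h => absurd ho h
  · intro s' _ h
    simp [leafProb, h]
  · exact fun h => absurd (Finset.mem_univ s) h

/-- After `k` steps the total discounted mass is `γ ^ k`. -/
theorem sum_leafProb (D : MDP S Act) (A : Agent S Act M N) (k : ℕ) :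
    ∀ (s : S) (o : Node M N), o ∈ Node.leaves M N →
      ∑ s', ∑ o' ∈ Node.leaves M N, leafProb D A k s' o' s o = D.γ ^ k := by
  induction k with
  | zero =>
    intro s o ho
    simpa using sum_leafProb_zero_smul D A (fun _ _ => (1 : ℝ)) s ho
  | succ k ih =>
    intro s o ho
    have h := sum_leafProb_succ_smul D A k (fun _ _ => (1 : ℝ)) s o
    simp only [smul_eq_mul, mul_one] at h
    have e : ∀ s'', ∑ o'' ∈ Node.leaves M N, D.γ * upDownProb A s'' o'' o * envProb D A s'' s o *
        ∑ s', ∑ o' ∈ Node.leaves M N, leafProb D A k s' o' s'' o'' =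
        D.γ ^ (k + 1) * envProb D A s'' s o := by
      intro s''
      have h1 : ∑ o'' ∈ Node.leaves M N, upDownProb A s'' o'' o = 1 :=
        sum_upDownProb A s'' (Node.mem_ofLen.mp ho)
      rw [← mul_one (D.γ ^ (k + 1) * envProb D A s'' s o), ← h1, Finset.mul_sum]
      refine Finset.sum_congr rfl fun o'' ho'' => ?_
      rw [ih s'' o'' ho'']
      ring
    rw [h, Finset.sum_congr rfl fun s'' _ => e s'', ← Finset.mul_sum,
      sum_envProb D A s (len_of_mem_leaves ho), mul_one]

theorem leafProb_le (D : MDP S Act) (A : Agent S Act M N) (k : ℕ) {s s' : S} {o o' : Node M N}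
    (ho : o ∈ Node.leaves M N) (ho' : o' ∈ Node.leaves M N) :
    leafProb D A k s' o' s o ≤ D.γ ^ k := by
  have hnn := fun s' o' => leafProb_nonneg D A k s' o' s o ho
  rw [← sum_leafProb D A k s o ho]
  exact (Finset.single_le_sum (fun o' _ => hnn s' o') ho').trans
    (Finset.single_le_sum (f := fun s' => ∑ o' ∈ Node.leaves M N, leafProb D A k s' o' s o)
      (fun s' _ => Finset.sum_nonneg fun o' _ => hnn s' o') (Finset.mem_univ s'))

theorem summable_leafProb (D : MDP S Act) (hγ : D.γ < 1) (A : Agent S Act M N) {s s' : S}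
    {o o' : Node M N} (ho : o ∈ Node.leaves M N) (ho' : o' ∈ Node.leaves M N) :
    Summable fun k => leafProb D A k s' o' s o :=
  Summable.of_nonneg_of_le (fun k => leafProb_nonneg D A k s' o' s o ho)
    (fun k => leafProb_le D A k ho ho') (summable_geometric_of_lt_one D.γ_nonneg hγ)

/-- A quantity on the leaf states that satisfies a linear recursion along the leaf-to-leaf kernel
is the integral of its source term against the discounted occupancy. -/
theorem eq_sum_occ_smul {G : Type*} [NormedAddCommGroup G] [NormedSpace ℝ G] (D : MDP S Act)
    (hγ : D.γ < 1) (A : Agent S Act M N) {F b : S → Node M N → G}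
    (hF : ∀ s, ∀ o ∈ Node.leaves M N, F s o = b s o + ∑ s'', ∑ o'' ∈ Node.leaves M N,
      (D.γ * upDownProb A s'' o'' o * envProb D A s'' s o) • F s'' o'')
    (s : S) {o : Node M N} (ho : o ∈ Node.leaves M N) :
    F s o = ∑ s', ∑ o' ∈ Node.leaves M N, occ D A s' o' s o • b s' o' := by
  have key : ∀ n : ℕ, F s o =
      (∑ k ∈ Finset.range n, ∑ s', ∑ o' ∈ Node.leaves M N, leafProb D A k s' o' s o • b s' o') +
        ∑ s', ∑ o' ∈ Node.leaves M N, leafProb D A n s' o' s o • F s' o' := by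
    intro n
    induction n generalizing s o with
    | zero => rw [sum_leafProb_zero_smul D A F s ho]; simp
    | succ n ih =>
      rw [Finset.sum_range_succ', sum_leafProb_zero_smul D A b s ho, hF s o ho]
      simp only [sum_leafProb_succ_smul]
      rw [add_comm _ (b s o), add_assoc]
      congr 1
      rw [Finset.sum_comm (s := Finset.range n), ← Finset.sum_add_distrib]
      refine Finset.sum_congr rfl fun s'' _ => ?_
      rw [Finset.sum_comm (s := Finset.range n), ← Finset.sum_add_distrib]
      refine Finset.sum_congr rfl fun o'' ho'' => ?_
      rw [← Finset.smul_sum, ← smul_add, ← ih s'' ho'']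
  have hsum : HasSum
      (fun k => ∑ s', ∑ o' ∈ Node.leaves M N, leafProb D A k s' o' s o • b s' o')
      (∑ s', ∑ o' ∈ Node.leaves M N, occ D A s' o' s o • b s' o') :=
    hasSum_sum fun s' _ => hasSum_sum fun o' ho' =>
      (summable_leafProb D hγ A ho ho').hasSum.smul_const _
  have hrem : Filter.Tendsto
      (fun n => ∑ s', ∑ o' ∈ Node.leaves M N, leafProb D A n s' o' s o • F s' o')
      Filter.atTop (nhds 0) := by
    have : Filter.Tendsto
        (fun n => ∑ s', ∑ o' ∈ Node.leaves M N, leafProb D A n s' o' s o • F s' o')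
        Filter.atTop (nhds (∑ s' : S, ∑ o' ∈ Node.leaves M N, (0 : ℝ) • F s' o')) :=
      tendsto_finsetSum _ fun s' _ => tendsto_finsetSum _ fun o' ho' =>
        (summable_leafProb D hγ A ho ho').tendsto_atTop_zero.smul_const _
    simpa using this
  have hlim := hsum.tendsto_sum_nat.add hrem
  rw [add_zero] at hlim
  exact tendsto_nhds_unique (tendsto_const_nhds.congr key) hlim

theorem sum_occNext_smul {G : Type*} [AddCommGroup G] [Module ℝ G] (D : MDP S Act)
    (A : Agent S Act M N) (s₀ : S) (o₀ : Node M N) (B : S → Node M N → S → G) :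
    ∑ s, ∑ o ∈ Node.leaves M N, ∑ s', occNext D A s' s o s₀ o₀ • B s o s' =
      ∑ s, ∑ o ∈ Node.leaves M N, occ D A s o s₀ o₀ • ∑ s', envProb D A s' s o • B s o s' := by
  simp only [occNext, mul_smul, Finset.smul_sum]

end Leaves

/-! ### The derivative of the Bellman equation -/

section Gradient

variable {S : Type*} [Fintype S] {Act : S → Type*} [∀ s, Fintype (Act s)] {M N : ℕ}
  {E : Type*} [NormedAddCommGroup E] [NormedSpace ℝ E] {A : E → Agent S Act M N} {θ : E}

theorem Q_down_of_lt (D : MDP S Act) (hγ : D.γ < 1) (A : Agent S Act M N) (s : S) {o : Node M N}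
    (h : o.len + 1 < N) :
    Q D A (.down s o) = ∑ c, A.optPol s o c * Q D A (.down s (o.child c)) := by
  rw [Q_eq D hγ A, next_down_of_lt D A _ s h]
  simp [reward, discount]

theorem Q_down_leaf (D : MDP S Act) (hγ : D.γ < 1) (A : Agent S Act M N) (s : S) {o : Node M N}
    (h : o.len + 1 = N) :
    Q D A (.down s o) = ∑ a, A.primPol s o a * Q D A (.act s o a) := by
  rw [Q_eq D hγ A, next_down_leaf D A _ s h]
  simp [reward, discount]

theorem Q_act (D : MDP S Act) (hγ : D.γ < 1) (A : Agent S Act M N) (s : S) (o : Node M N)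
    (a : Act s) :
    Q D A (.act s o a) =
      ∑ s', D.P s a s' * D.R s a s' + D.γ * ∑ s', D.P s a s' * Q D A (.up s' o) := by
  rw [Q_eq D hγ A, next_act]
  simp [reward, discount]

theorem Q_up (D : MDP S Act) (hγ : D.γ < 1) (A : Agent S Act M N) (s : S) (o : Node M N) :
    Q D A (.up s o) =
      A.beta s o * Q D A (.up s o.parent) + (1 - A.beta s o) * Q D A (.down s o) := by
  rw [Q_eq D hγ A, next_up]
  simp [reward, discount]

theorem fderiv_Q_down_of_lt (D : MDP S Act) (hγ : D.γ < 1)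
    (hQ : ∀ x, DifferentiableAt ℝ (fun t => Q D (A t) x) θ)
    (h_opt : ∀ s o c, o.len + 1 < N → DifferentiableAt ℝ (fun t => (A t).optPol s o c) θ)
    (s : S) {o : Node M N} (h : o.len + 1 < N) :
    fderiv ℝ (fun t => Q D (A t) (.down s o)) θ =
      ∑ c, QOpt D (A θ) s o c • fderiv ℝ (fun t => (A t).optPol s o c) θ +
      ∑ c, (A θ).optPol s o c • fderiv ℝ (fun t => Q D (A t) (.down s (o.child c))) θ := by
  simp only [fun t => Q_down_of_lt D hγ (A t) s h]
  rw [← Finset.sum_add_distrib]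
  refine (HasFDerivAt.fun_sum fun c _ => ?_).fderiv
  rw [add_comm]
  exact (h_opt s o c h).hasFDerivAt.mul (hQ _).hasFDerivAt

theorem fderiv_Q_down_leaf (D : MDP S Act) (hγ : D.γ < 1)
    (hQ : ∀ x, DifferentiableAt ℝ (fun t => Q D (A t) x) θ)
    (h_prim : ∀ s o a, o.len + 1 = N → DifferentiableAt ℝ (fun t => (A t).primPol s o a) θ)
    (s : S) {o : Node M N} (h : o.len + 1 = N) :
    fderiv ℝ (fun t => Q D (A t) (.down s o)) θ =
      ∑ a, QPrim D (A θ) s o a • fderiv ℝ (fun t => (A t).primPol s o a) θ +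
      ∑ s', (D.γ * envProb D (A θ) s' s o) • fderiv ℝ (fun t => Q D (A t) (.up s' o)) θ := by
  have hact : ∀ a, fderiv ℝ (fun t => Q D (A t) (.act s o a)) θ =
      D.γ • ∑ s', D.P s a s' • fderiv ℝ (fun t => Q D (A t) (.up s' o)) θ := by
    intro a
    simp only [fun t => Q_act D hγ (A t) s o a]
    exact (((HasFDerivAt.fun_sum fun s' _ =>
      (hQ (.up s' o)).hasFDerivAt.const_mul (D.P s a s')).const_mul D.γ).const_add _).fderiv
  have hdown : fderiv ℝ (fun t => Q D (A t) (.down s o)) θ =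
      ∑ a, QPrim D (A θ) s o a • fderiv ℝ (fun t => (A t).primPol s o a) θ +
      ∑ a, (A θ).primPol s o a • fderiv ℝ (fun t => Q D (A t) (.act s o a)) θ := by
    simp only [fun t => Q_down_leaf D hγ (A t) s h]
    rw [← Finset.sum_add_distrib]
    refine (HasFDerivAt.fun_sum fun a _ => ?_).fderiv
    rw [add_comm]
    exact (h_prim s o a h).hasFDerivAt.mul (hQ _).hasFDerivAt
  rw [hdown]
  congr 1
  simp only [hact, envProb, Finset.smul_sum, Finset.mul_sum, Finset.sum_smul, smul_smul]
  rw [Finset.sum_comm]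
  refine Finset.sum_congr rfl fun s' _ => Finset.sum_congr rfl fun a _ => ?_
  congr 1
  ring

theorem fderiv_Q_up (D : MDP S Act) (hγ : D.γ < 1)
    (hQ : ∀ x, DifferentiableAt ℝ (fun t => Q D (A t) x) θ)
    (h_beta : ∀ s o, DifferentiableAt ℝ (fun t => (A t).beta s o) θ) (s : S) (o : Node M N) :
    fderiv ℝ (fun t => Q D (A t) (.up s o)) θ =
      -((QBeta D (A θ) s o 0 - QBeta D (A θ) s o 1) • fderiv ℝ (fun t => (A t).beta s o) θ) +
      (A θ).beta s o • fderiv ℝ (fun t => Q D (A t) (.up s o.parent)) θ +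
      (1 - (A θ).beta s o) • fderiv ℝ (fun t => Q D (A t) (.down s o)) θ := by
  simp only [fun t => Q_up D hγ (A t) s o]
  have hb := (h_beta s o).hasFDerivAt
  refine ((hb.mul (hQ (.up s o.parent)).hasFDerivAt).add
    ((hb.const_sub 1).mul (hQ (.down s o)).hasFDerivAt)).fderiv.trans ?_
  simp only [QBeta]
  module

/-- The derivative of the value of an upward leaf state, unrolled along the upward and the downward
phase that follow. -/
theorem fderiv_Q_up_leaf (D : MDP S Act) (hγ : D.γ < 1)
    (hQ : ∀ x, DifferentiableAt ℝ (fun t => Q D (A t) x) θ)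
    (h_opt : ∀ s o c, o.len + 1 < N → DifferentiableAt ℝ (fun t => (A t).optPol s o c) θ)
    (h_beta : ∀ s o, DifferentiableAt ℝ (fun t => (A t).beta s o) θ) (s : S) {o : Node M N}
    (ho : o ∈ Node.leaves M N) :
    fderiv ℝ (fun t => Q D (A t) (.up s o)) θ =
      -(∑ l ∈ Finset.Icc 1 (N - 1),
          ((∏ k ∈ Finset.Icc (l + 1) (N - 1), (A θ).beta s (o.pre k)) *
            (QBeta D (A θ) s (o.pre l) 0 - QBeta D (A θ) s (o.pre l) 1)) •
            fderiv ℝ (fun t => (A t).beta s (o.pre l)) θ) +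
      (∑ j ∈ Finset.Icc 1 (N - 1), (∏ k ∈ Finset.Icc j (N - 1), (A θ).beta s (o.pre k)) •
        ∑ o' ∈ Node.ofLen M N (j - 1), ∑ c,
          (upDownProb (A θ) s o' (o.pre (j - 1)) * QOpt D (A θ) s o' c) •
            fderiv ℝ (fun t => (A t).optPol s o' c) θ) +
      ∑ o' ∈ Node.leaves M N,
        upDownProb (A θ) s o' o • fderiv ℝ (fun t => Q D (A t) (.down s o')) θ := by
  have h := eq_sum_upDownProb (A θ) s
    (U := fun o => fderiv ℝ (fun t => Q D (A t) (.up s o)) θ)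
    (F := fun o => fderiv ℝ (fun t => Q D (A t) (.down s o)) θ)
    (bU := fun o => -((QBeta D (A θ) s o 0 - QBeta D (A θ) s o 1) •
      fderiv ℝ (fun t => (A t).beta s o) θ))
    (bF := fun o => ∑ c, QOpt D (A θ) s o c • fderiv ℝ (fun t => (A t).optPol s o c) θ)
    (fderiv_Q_up D hγ hQ h_beta s)
    (fun o h => fderiv_Q_down_of_lt D hγ hQ h_opt s h)
    -- The root never terminates, whatever the parameter.
    (fun o h => by simp [fun t => (A t).beta_root s o h])
    (N - 1) o (Node.mem_ofLen.mp ho)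
  rw [h]
  simp only [smul_neg, Finset.sum_neg_distrib, Finset.smul_sum, smul_smul]
  rfl

end Gradient

end HOC

theorem theorem2 {S : Type*} [Fintype S] {Act : S → Type*} [∀ s, Fintype (Act s)] {M N : ℕ}
    (D : HOC.MDP S Act) (hγ : D.γ < 1)
    {E : Type*} [NormedAddCommGroup E] [NormedSpace ℝ E]
    (A : E → HOC.Agent S Act M N) (θ : E)
    (h_opt : ∀ s o c, o.len + 1 < N → DifferentiableAt ℝ (fun t => (A t).optPol s o c) θ)
    (h_prim : ∀ s o a, o.len + 1 = N → DifferentiableAt ℝ (fun t => (A t).primPol s o a) θ)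
    (h_beta : ∀ s o, DifferentiableAt ℝ (fun t => (A t).beta s o) θ)
    (s₀ : S) (o₀ : HOC.Node M N) (ho₀ : o₀ ∈ HOC.Node.leaves M N) :
    (∀ t x, Summable (fun n => HOC.discReward D (A t) n x)) ∧
    (∀ s, ∀ o ∈ HOC.Node.leaves M N,
      Summable (fun k => HOC.leafProb D (A θ) k s o s₀ o₀)) ∧
    HasFDerivAt (fun t => HOC.Q D (A t) (.down s₀ o₀))
      (∑ s, ∑ o ∈ HOC.Node.leaves M N, ∑ s',
        HOC.occNext D (A θ) s' s o s₀ o₀ •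
          ((∑ a, HOC.QPrim D (A θ) s o a • fderiv ℝ (fun t => (A t).primPol s o a) θ)
          - D.γ • (∑ l ∈ Finset.Icc 1 (N - 1),
              ((∏ k ∈ Finset.Icc (l + 1) (N - 1), (A θ).beta s' (o.pre k)) *
                (HOC.QBeta D (A θ) s' (o.pre l) 0 - HOC.QBeta D (A θ) s' (o.pre l) 1)) •
                fderiv ℝ (fun t => (A t).beta s' (o.pre l)) θ)
          + D.γ • (∑ j ∈ Finset.Icc 1 (N - 1),
              (∏ k ∈ Finset.Icc j (N - 1), (A θ).beta s' (o.pre k)) •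
                (∑ o' ∈ HOC.Node.ofLen M N (j - 1), ∑ c,
                  (HOC.upDownProb (A θ) s' o' (o.pre (j - 1)) *
                    HOC.QOpt D (A θ) s' o' c) •
                    fderiv ℝ (fun t => (A t).optPol s' o' c) θ))))
      θ := by
  refine ⟨fun t x => HOC.summable_discReward D hγ (A t) x,
    fun s o ho => HOC.summable_leafProb D hγ (A θ) ho₀ ho, ?_⟩
  have hQ := HOC.differentiableAt_Q D hγ h_opt h_prim h_beta
  refine (hQ (.down s₀ o₀)).hasFDerivAt.congr_fderiv ?_
  rw [HOC.sum_occNext_smul]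
  refine HOC.eq_sum_occ_smul D hγ (A θ)
    (F := fun s o => fderiv ℝ (fun t => HOC.Q D (A t) (.down s o)) θ) ?_ s₀ ho₀
  intro s o ho
  have hl := HOC.len_of_mem_leaves ho
  rw [HOC.fderiv_Q_down_leaf D hγ hQ h_prim s hl]
  -- The source term of the leaf policy does not depend on the successor state `s'`.
  conv_lhs =>
    rw [← one_smul ℝ (∑ a, HOC.QPrim D (A θ) s o a • fderiv ℝ (fun t => (A t).primPol s o a) θ),
      ← HOC.sum_envProb D (A θ) s hl, Finset.sum_smul]
  rw [← Finset.sum_add_distrib, ← Finset.sum_add_distrib]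
  refine Finset.sum_congr rfl fun s' _ => ?_
  have e : ∑ o' ∈ HOC.Node.leaves M N,
      (D.γ * HOC.upDownProb (A θ) s' o' o * HOC.envProb D (A θ) s' s o) •
        fderiv ℝ (fun t => HOC.Q D (A t) (.down s' o')) θ =
      (D.γ * HOC.envProb D (A θ) s' s o) • ∑ o' ∈ HOC.Node.leaves M N,
        HOC.upDownProb (A θ) s' o' o • fderiv ℝ (fun t => HOC.Q D (A t) (.down s' o')) θ := by
    rw [Finset.smul_sum]
    refine Finset.sum_congr rfl fun o' _ => ?_
    rw [smul_smul]
    congr 1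
    ring
  rw [e, HOC.fderiv_Q_up_leaf D hγ hQ h_opt h_beta s' ho]
  module
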